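/- **Theorem (Variation of dissipation energy).** Let $U\subset\mathbb{R}^2$ be a bounded domain whose boundary is a closed chain of finitely many Lipschitz curves with a.e. non-vanishing velocity, and let $\widehat{x}$ be the restriction to $\overline{U}\times[0,T)$ of a $C^2$ map $\mathbb{R}^2\times\mathbb{R}\to\mathbb{R}^3$ such that $\partial_{X_1}\widehat{x}\times\partial_{X_2}\widehat{x}\neq0$ on $\overline{U}\times[0,T)$ and $\widehat{x}(\cdot,t)$ is injective on $U$ for $0<t<T$. Put $\Gamma(t)=\widehat{x}(U,t)$ and $\partial\Gamma(t)=\widehat{x}(\partial U,t)$. Fix $0\le t<T$; if $t=0$, assume that $\widehat{x}(\cdot,0)$ is injective on $U$ as well. Let $n$ be the unit normal of $\Gamma(t)$ in the direction $\partial_{X_1}\widehat{x}\times\partial_{X_2}\widehat{x}$, and let $\partial_j^\Gamma g=\sum_{i}(\delta_{ij}-n_in_j)\partial_i g$, $\nabla_\Gamma g=\mathrm{grad}_\Gamma\, g=(\partial_1^\Gamma g,\partial_2^\Gamma g,\partial_3^\Gamma g)$, $\mathrm{div}_\Gamma\varphi=\sum_j\partial_j^\Gamma\varphi_j$. Let $e_D:[0,\infty)\to\mathbb{R}$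 be $C^1$, let $f$ be the restriction to $\overline{\Gamma(t)}$ of a $C^2$ function on $\mathbb{R}^3$, and let $\psi$ be the restriction to $\Gamma(t)$ of a $C^1$ function on $\mathbb{R}^3$ such that the closure in $\mathbb{R}^3$ of $\{x\in\Gamma(t):\psi(x)\ne0\}$ does not meet $\partial\Gamma(t)$. For $-1<\varepsilon<1$ set $$E_D[f+\varepsilon\psi](t)=-\int_{\Gamma(t)}\tfrac12 e_D\big(|\nabla_\Gamma(f+\varepsilon\psi)|^2\big)\,d\mathcal{H}^2_x ,$$ where the integrand is integrable. Suppose that the field $e_D'(|\mathrm{grad}_\Gamma f|^2)\,\mathrm{grad}_\Gamma f$ is $C^1$ on $\Gamma(t)\setminus\partial\Gamma(t)$ (near each point of this set it is the restriction to $\Gamma(t)$ of a $C^1$ field on an open subset of $\mathbb{R}^3$), so that its surface divergence is defined there; this is always the case if $e_D$ is $C^2$. Then the integrand on the right-hand side below is integrable, the derivative on the left-hand side exists, and $$\frac{d}{d\varepsilon}\bigg|_{\varepsilon=0}E_D[f+\varepsilon\psi](t)=\int_{\Gamma(t)}\mathrm{div}_\Gamma\{e_D'(|\mathrm{grad}_\Gamma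 f|^2)\,\mathrm{grad}_\Gamma f\}\,\psi\,d\mathcal{H}^2_x .$$ -/

import Mathlib

open Set Filter Topology MeasureTheory

noncomputable section

/-- The plane of parameters. -/
abbrev E2 : Type := EuclideanSpace ℝ (Fin 2)

/-- Euclidean space `ℝ³`. -/
abbrev E3 : Type := EuclideanSpace ℝ (Fin 3)

/-- The boundary of `U ⊆ ℝ²` is piecewise Lipschitz-continuous: it is a closed chain of finitely many
Lipschitz curves `ℓ ↦ (p m ℓ, q m ℓ)`, `ℓ ∈ [a m, b m]`, whose velocity is non-zero for almost every
`ℓ`. The indices are cyclic: the successor of the last element of `Fin (M + 1)` is `0`. -/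
def HasPiecewiseLipschitzBoundary (U : Set E2) : Prop :=
  ∃ (M : ℕ) (a b : Fin (M + 1) → ℝ) (p q : Fin (M + 1) → ℝ → ℝ),
    (∀ m, a m < b m) ∧
    (∀ m, ∃ K, LipschitzOnWith K (p m) (Icc (a m) (b m))) ∧
    (∀ m, ∃ K, LipschitzOnWith K (q m) (Icc (a m) (b m))) ∧
    (∀ m, p m (b m) = p (m + 1) (a (m + 1)) ∧ q m (b m) = q (m + 1) (a (m + 1))) ∧
    (∀ m, ∀ᵐ l ∂(volume.restrict (Icc (a m) (b m))),
      0 < (deriv (p m) l) ^ 2 + (deriv (q m) l) ^ 2) ∧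
    frontier U = ⋃ m, (fun l => (!₂[p m l, q m l] : E2)) '' Icc (a m) (b m)

/-- The cross product of two vectors of `ℝ³`. -/
def cross (v w : E3) : E3 := WithLp.toLp 2 (crossProduct v.ofLp w.ofLp)

/-- The tangent vector `𝔤_α = ∂x/∂X_α` of a parametrization `x` at the point `X`. -/
def tangentVec (x : E2 → E3) (α : Fin 2) (X : E2) : E3 :=
  fderiv ℝ x X (EuclideanSpace.single α 1)

/-- An evolving surface with a piecewise Lipschitz-continuous boundary, on the time interval `[0, T)`.
A `C²` function on `closure U × [0, T)` is by definition the restriction of a `C²` function on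
`ℝ² × ℝ`; `param` is such an extension. Only its values on `closure U × [0, T)` matter: they determine
the spatial derivatives there, because `U` is open. -/
structure EvolvingSurface (T : ℝ) where
  /-- the bounded domain of parameters -/
  U : Set E2
  isOpen_U : IsOpen U
  isConnected_U : IsConnected U
  isBounded_U : Bornology.IsBounded U
  boundary_U : HasPiecewiseLipschitzBoundary U
  /-- the parametrization: `param t X` is the point with parameter `X` at time `t` -/
  param : ℝ → E2 → E3
  contDiff_param : ContDiff ℝ 2 (fun z : E2 × ℝ => param z.2 z.1)
  injOn_param : ∀ t, 0 < t → t < T → InjOn (param t) U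
  immersion : ∀ t, 0 ≤ t → t < T → ∀ X ∈ closure U,
    0 < ∑ i : Fin 3, (cross (tangentVec (param t) 0 X) (tangentVec (param t) 1 X) i) ^ 2

namespace EvolvingSurface

variable {T : ℝ} (S : EvolvingSurface T)

/-- The surface `Γ(t)`, the image of the open domain `U`. -/
def surface (t : ℝ) : Set E3 := S.param t '' S.U

/-- The boundary `∂Γ(t)` of the surface, the image of the boundary of `U`. -/
def bdry (t : ℝ) : Set E3 := S.param t '' frontier S.U

/-- The unit normal vector at a point `x` of `Γ(t)`: it is `𝔤₁ × 𝔤₂ / |𝔤₁ × 𝔤₂|` at the parameter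
`X ∈ U` of `x`. -/
def normal (t : ℝ) (x : E3) : E3 :=
  let X := Function.invFunOn (S.param t) S.U x
  let N := cross (tangentVec (S.param t) 0 X) (tangentVec (S.param t) 1 X)
  ‖N‖⁻¹ • N

/-- The tangential derivative `∂_j^Γ g = ∑ i, (δ_ij - n_i n_j) ∂_i g` of a function on `Γ(t)`.
Here `∂_i g` are the components of a derivative of `g` within the set `Γ(t)`. Such a derivative (as
the derivative of an extension of `g` to a neighbourhood) is unique only up to a multiple of `n`,
and the projection removes this ambiguity. -/
def tderiv (t : ℝ) (j : Fin 3) (g : E3 → ℝ) (x : E3) : ℝ :=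
  ∑ i : Fin 3, ((if i = j then 1 else 0) - S.normal t x i * S.normal t x j) *
    fderivWithin ℝ g (S.surface t) x (EuclideanSpace.single i 1)

/-- The surface gradient `grad_Γ g = ∇_Γ g`. -/
def grad (t : ℝ) (g : E3 → ℝ) (x : E3) : E3 :=
  WithLp.toLp 2 fun j => S.tderiv t j g x

/-- The surface divergence `div_Γ φ = ∑ j, ∂_j^Γ φ_j`. -/
def div (t : ℝ) (φ : E3 → E3) (x : E3) : ℝ :=
  ∑ j : Fin 3, S.tderiv t j (fun y => φ y j) x

/-- The field `e'(|∇_Γ f|²) ∇_Γ f`. The function `e` lives on `[0, ∞)`, and its derivative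
at `0` is the one-sided one. -/
def flux (t : ℝ) (e : ℝ → ℝ) (f : E3 → ℝ) (x : E3) : E3 :=
  derivWithin e (Ici 0) (‖S.grad t f x‖ ^ 2) • S.grad t f x

/-- The dissipation energy `E_D[g](t) = - ∫_Γ(t) ½ e(|∇_Γ g|²) dH²`, with `H²` the two-dimensional
Hausdorff measure (normalized to be the area on planes). -/
def energy (t : ℝ) (e : ℝ → ℝ) (g : E3 → ℝ) : ℝ :=
  -∫ x in S.surface t, 1 / 2 * e (‖S.grad t g x‖ ^ 2) ∂μHE[2]

/-- `ψ ∈ C_0^k(Γ(t))`: `ψ` is on `Γ(t)` the restriction of a `C^k` function on `ℝ³`, and its support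
(a closed subset of `ℝ³`) does not meet `∂Γ(t)`. -/
def IsCk0 (t : ℝ) (k : ℕ) (ψ : E3 → ℝ) : Prop :=
  (∃ F : E3 → ℝ, ContDiff ℝ k F ∧ EqOn ψ F (S.surface t)) ∧
    Disjoint (closure {x ∈ S.surface t | ψ x ≠ 0}) (S.bdry t)

/-- `f ∈ C^k(closure Γ(t))`: `f` is there the restriction of a `C^k` function on `ℝ³`. -/
def IsCk (t : ℝ) (k : ℕ) (f : E3 → ℝ) : Prop :=
  ∃ F : E3 → ℝ, ContDiff ℝ k F ∧ EqOn f F (closure (S.surface t))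

/-- A vector field on the surface is `C¹` off the boundary: near each point of `Γ(t)` that is not on
`∂Γ(t)` it is the restriction to `Γ(t)` of a `C¹` field on an open subset of `ℝ³`. -/
def IsC1OffBdry (t : ℝ) (φ : E3 → E3) : Prop :=
  ∀ x ∈ S.surface t \ S.bdry t, ∃ Φ : E3 → E3,
    ContDiffAt ℝ 1 Φ x ∧ φ =ᶠ[𝓝[S.surface t] x] Φ

end EvolvingSurface

end

/-! Everything is pulled back to the plane domain `U`. By the area formula, an integral over `Γ(t)`
becomes an integral over `U` with density `‖normalVec‖`, and there the surface gradient becomes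
`pullGrad`, which is linear in the function. For extensions of `f` and `ψ` it gives fields `a`, `b`
continuous on the compact closure of `U`, and the energy density at `f + εψ` is `½ e(|a + εb|²)`.
Differentiation under the integral sign (`hasDerivAt_integral_energy_density`) yields the integral
of the flux `e'(|a|²) a` against `b`; the `½` cancels the factor `2` from the square.

It remains to integrate by parts. For a tangential field `φ`, the density times the surface
divergence is the plane divergence of the components `densityComp` (`sum_coordDeriv_densityComp`).
Multiplying these by a test function gives a compactly supported `C¹` plane field whose divergence
integrates to zero (`integral_inner_pullGrad_eq_neg_integral_div`). The pull-back of `ψ`, extended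
by zero, is such a test function: a point of its support on the frontier of `U` would be mapped into
`∂Γ(t)`.

The parametrization need not be injective up to the frontier, so `Γ(t)` may meet `∂Γ(t)`. Regularity
of the flux is available only off `∂Γ(t)`, which suffices because the support of `ψ` avoids it. For
`C²` densities this regularity comes from a local left inverse of the immersion and
`nhdsWithin_surface_le_map`. -/

noncomputable section

/-! ### Area formula for injective immersions -/

section AreaFormula

open Module Measure
open scoped NNReal ENNReal

/-- If distances of `f`-images are at most `K` times the distances of `g`-images on `B`, then the
`d`-dimensional measure of `f '' B` is at most `K ^ d` times that of `g '' B`. -/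
lemma euclideanHausdorffMeasure_image_le_of_dist_le {X Y Z : Type*} [MetricSpace Y]
    [MeasurableSpace Y] [BorelSpace Y] [MetricSpace Z] [MeasurableSpace Z] [BorelSpace Z]
    {f : X → Y} {g : X → Z} {B : Set X} {K : ℝ≥0}
    (h : ∀ x ∈ B, ∀ y ∈ B, dist (f x) (f y) ≤ K * dist (g x) (g y)) (d : ℕ) :
    μHE[d] (f '' B) ≤ (K : ℝ≥0∞) ^ d * μHE[d] (g '' B) := by
  rcases B.eq_empty_or_nonempty with rfl | ⟨x₀, hx₀⟩
  · simp
  have : Nonempty X := ⟨x₀⟩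
  have hinv : ∀ z ∈ g '' B, Function.invFunOn g B z ∈ B ∧ g (Function.invFunOn g B z) = z :=
    fun z hz => Function.invFunOn_pos hz
  have hL : LipschitzOnWith K (fun z => f (Function.invFunOn g B z)) (g '' B) := by
    refine LipschitzOnWith.of_dist_le_mul fun z hz w hw => ?_
    have := h _ (hinv z hz).1 _ (hinv w hw).1
    rwa [(hinv z hz).2, (hinv w hw).2] at this
  have himg : f '' B = (fun z => f (Function.invFunOn g B z)) '' (g '' B) := by
    apply Subset.antisymm
    · rintro _ ⟨x, hx, rfl⟩
      refine ⟨g x, ⟨x, hx, rfl⟩, ?_⟩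
      -- The chosen preimage may differ from `x`, but points with equal `g`-values have equal
      -- `f`-values by the distance bound.
      have hgx := hinv (g x) ⟨x, hx, rfl⟩
      have := h _ hgx.1 _ hx
      rw [hgx.2, dist_self, mul_zero] at this
      exact dist_le_zero.1 this
    · rintro _ ⟨z, hz, rfl⟩
      exact ⟨_, (hinv z hz).1, rfl⟩
  have := hL.hausdorffMeasure_image_le (d := d) (by positivity)
  rw [← himg, ENNReal.rpow_natCast] at this
  simp only [euclideanHausdorffMeasure_def, Measure.smul_apply, nnreal_smul_coe_apply]
  calc _ ≤ _ := mul_le_mul_right this _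
    _ = _ := mul_left_comm _ _ _

/-- Near a point of strict differentiability with injective derivative `A`, a map distorts
distances as `A` does, up to a factor close to `1`. -/
lemma HasStrictFDerivAt.eventually_dist_comparable {E F : Type*} [NormedAddCommGroup E]
    [NormedSpace ℝ E] [FiniteDimensional ℝ E] [NormedAddCommGroup F] [NormedSpace ℝ F]
    {f : E → F} {A : E →L[ℝ] F} {x : E} (hf : HasStrictFDerivAt f A x)
    (hA : Function.Injective A) {c : ℝ≥0} (hc : 1 < c) :
    ∃ W ∈ 𝓝 x, ∀ y ∈ W, ∀ z ∈ W, dist (f y) (f z) ≤ c * dist (A y) (A z) ∧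
      dist (A y) (A z) ≤ c * dist (f y) (f z) := by
  obtain ⟨K, hK0, hK⟩ := A.toLinearMap.exists_antilipschitzWith (LinearMap.ker_eq_bot.2 hA)
  have hc' : (1 : ℝ) < c := hc
  -- With `K` the antilipschitz constant of `A`, this tolerance makes the linearization error at
  -- most `(1 - 1/c) ‖A (y - z)‖`.
  have hε : (0 : ℝ) < (c - 1) / (c * K) := by
    have : (0 : ℝ) < K := hK0
    have := sub_pos.2 hc'
    positivity
  obtain ⟨W, hW, happ⟩ := hf.approximates_deriv_on_nhds
    (c := ⟨(c - 1) / (c * K), hε.le⟩) (Or.inr hε)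
  refine ⟨W, hW, fun y hy z hz => ?_⟩
  have h1 : ‖f y - f z - A (y - z)‖ ≤ (c - 1) / (c * K) * ‖y - z‖ := happ y hy z hz
  have h2 : ‖y - z‖ ≤ K * ‖A (y - z)‖ := by
    have := hK.le_mul_dist y z
    simpa [dist_eq_norm, ← map_sub] using this
  have h3 : (c - 1) / (c * K) * ‖y - z‖ ≤ (c - 1) / c * ‖A (y - z)‖ := by
    calc _ ≤ (c - 1) / (c * K) * (K * ‖A (y - z)‖) := mul_le_mul_of_nonneg_left h2 hε.le
      _ = _ := by
        have : (K : ℝ) ≠ 0 := (show (0 : ℝ) < K from hK0).ne'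
        field_simp
  have h4 := norm_le_norm_add_norm_sub' (f y - f z) (A (y - z))
  have h5 := norm_le_norm_add_norm_sub (f y - f z) (A (y - z))
  rw [dist_eq_norm, dist_eq_norm, ← map_sub]
  have hcc : (c - 1 : ℝ) / c = 1 - 1 / c := by field_simp
  have hci : (c : ℝ) * (1 / c) = 1 := by field_simp
  rw [hcc] at h3
  have hi : (0 : ℝ) < 1 / c := by positivity
  have hn := norm_nonneg (A (y - z))
  constructor
  -- This is `c + 1/c ≥ 2`.
  · have : 2 - 1 / (c : ℝ) ≤ c := by
      have hi' : (0 : ℝ) < 1 / c := hi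
      nlinarith [mul_nonneg hi'.le (sq_nonneg ((c : ℝ) - 1))]
    nlinarith
  · have : 1 / (c : ℝ) * ‖A (y - z)‖ ≤ ‖f y - f z‖ := by linarith
    calc _ = c * (1 / (c : ℝ) * ‖A (y - z)‖) := by rw [← mul_assoc, hci, one_mul]
      _ ≤ _ := mul_le_mul_of_nonneg_left this (by positivity)

lemma ENNReal.le_of_forall_one_lt_pow_mul {a b : ℝ≥0∞} (n : ℕ)
    (h : ∀ c : ℝ≥0, 1 < c → a ≤ (c : ℝ≥0∞) ^ n * b) : a ≤ b := by
  have ht : Tendsto (fun c : ℝ≥0 => (c : ℝ≥0∞) ^ n * b) (𝓝[>] 1) (𝓝 (1 * b)) := by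
    refine ENNReal.Tendsto.mul_const ?_ (Or.inl one_ne_zero)
    have : Continuous fun c : ℝ≥0 => (c : ℝ≥0∞) ^ n :=
      (ENNReal.continuous_pow n).comp ENNReal.continuous_coe
    simpa using (this.tendsto 1).mono_left nhdsWithin_le_nhds
  rw [one_mul] at ht
  exact ge_of_tendsto ht (eventually_mem_nhdsWithin.mono fun c hc => h c hc)

variable {E F : Type*} [NormedAddCommGroup E] [InnerProductSpace ℝ E] [FiniteDimensional ℝ E]
  [MeasurableSpace E] [BorelSpace E] [NormedAddCommGroup F] [InnerProductSpace ℝ F]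
  [MeasurableSpace F] [BorelSpace F]

/-- For the linear map `A` the measure of an image is exactly `J x` times volume. Replacing `f` by
`A` costs a factor `c` per dimension, and freezing `J` at `x` costs one more, hence the exponent. -/
lemma eventually_measure_image_comparable {f : E → F} {A : E →L[ℝ] F} {J : E → ℝ} {x : E}
    (hf : HasStrictFDerivAt f A x) (hA : Function.Injective A)
    (hJx : J x = A.toLinearMap.normDet) (hJ : ContinuousAt J x)
    {c : ℝ≥0} (hc : 1 < c) :
    ∃ W ∈ 𝓝 x, ∀ B ⊆ W, MeasurableSet B →
      μHE[finrank ℝ E] (f '' B) ≤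
        (c : ℝ≥0∞) ^ (finrank ℝ E + 1) * ∫⁻ y in B, ENNReal.ofReal (J y) ∧
      ∫⁻ y in B, ENNReal.ofReal (J y) ≤
        (c : ℝ≥0∞) ^ (finrank ℝ E + 1) * μHE[finrank ℝ E] (f '' B) := by
  obtain ⟨W, hW, hWd⟩ := hf.eventually_dist_comparable hA hc
  have hJ0 : 0 < J x := by
    rw [hJx]
    refine lt_of_le_of_ne (LinearMap.normDet_nonneg _) (Ne.symm ?_)
    exact ((A.toLinearMap.normDet_ne_zero_tfae).out 0 4).2 hA
  have hc' : (1 : ℝ) < c := hc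
  have hup : ∀ᶠ y in 𝓝 x, J y < c * J x := by
    refine hJ.eventually_lt continuousAt_const ?_
    nlinarith
  have hlo : ∀ᶠ y in 𝓝 x, J x < c * J y := by
    refine continuousAt_const.eventually_lt (continuousAt_const.mul hJ) ?_
    nlinarith
  refine ⟨W ∩ {y | J y < c * J x ∧ J x < c * J y}, inter_mem hW (hup.and hlo),
    fun B hB hBm => ?_⟩
  have h1 := euclideanHausdorffMeasure_image_le_of_dist_le (f := f) (g := A.toLinearMap)
    (B := B) (K := c) (fun y hy z hz => (hWd y (hB hy).1 z (hB hz).1).1) (finrank ℝ E)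
  have h2 := euclideanHausdorffMeasure_image_le_of_dist_le (f := A.toLinearMap) (g := f)
    (B := B) (K := c) (fun y hy z hz => (hWd y (hB hy).1 z (hB hz).1).2) (finrank ℝ E)
  rw [LinearMap.euclideanHausdorffMeasure_image_eq_normDet_mul_volume, ← hJx] at h1 h2
  have hmul : ∀ a b : ℝ, 0 ≤ b → a ≤ c * b → ENNReal.ofReal a ≤ c * ENNReal.ofReal b := by
    intro a b _ hab
    rw [← ENNReal.ofReal_coe_nnreal, ← ENNReal.ofReal_mul (by positivity)]
    exact ENNReal.ofReal_le_ofReal hab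
  have hpos : ∀ y ∈ B, 0 ≤ J y := fun y hy => by
    have := (hB hy).2.2
    have hcp : (0 : ℝ) < c := by linarith
    exact (pos_of_mul_pos_right (hJ0.trans this) hcp.le).le
  have h3 : ENNReal.ofReal (J x) * volume B ≤ c * ∫⁻ y in B, ENNReal.ofReal (J y) := by
    rw [← lintegral_const_mul' _ _ ENNReal.coe_ne_top, ← setLIntegral_const]
    exact setLIntegral_mono' hBm fun y hy => hmul _ _ (hpos y hy) (hB hy).2.2.le
  have h4 : ∫⁻ y in B, ENNReal.ofReal (J y) ≤ c * (ENNReal.ofReal (J x) * volume B) := by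
    rw [← mul_assoc, ← setLIntegral_const]
    exact setLIntegral_mono' hBm fun y hy => hmul _ _ hJ0.le (hB hy).2.1.le
  constructor
  · rw [pow_succ, mul_assoc]
    exact h1.trans (mul_le_mul_right h3 _)
  · rw [pow_succ', mul_assoc]
    exact h4.trans (mul_le_mul_right h2 _)

/-- Area formula, set version. -/
theorem euclideanHausdorffMeasure_image_eq_lintegral_normDet {f : E → F} {f' : E → E →L[ℝ] F}
    {U : Set E} (hU : IsOpen U) (hf : ∀ x ∈ U, HasStrictFDerivAt f (f' x) x)
    (hf' : ∀ x ∈ U, Function.Injective (f' x)) (hinj : InjOn f U) {J : E → ℝ}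
    (hJ : ContinuousOn J U) (hJf : ∀ x ∈ U, J x = (f' x).toLinearMap.normDet)
    {B : Set E} (hB : MeasurableSet B) (hBU : B ⊆ U) :
    μHE[finrank ℝ E] (f '' B) = ∫⁻ y in B, ENNReal.ofReal (J y) := by
  have hcont : ContinuousOn f U := fun x hx => (hf x hx).continuousAt.continuousWithinAt
  have key : ∀ c : ℝ≥0, 1 < c →
      μHE[finrank ℝ E] (f '' B) ≤
        (c : ℝ≥0∞) ^ (finrank ℝ E + 1) * ∫⁻ y in B, ENNReal.ofReal (J y) ∧
      ∫⁻ y in B, ENNReal.ofReal (J y) ≤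
        (c : ℝ≥0∞) ^ (finrank ℝ E + 1) * μHE[finrank ℝ E] (f '' B) := by
    intro c hc
    -- Quantified over all `x`, with the empty set as default outside `U`, so that `choose` gives a
    -- total function.
    have hloc : ∀ x, ∃ W, IsOpen W ∧ (x ∈ U → x ∈ W) ∧ ∀ B ⊆ W, MeasurableSet B →
        μHE[finrank ℝ E] (f '' B) ≤
          (c : ℝ≥0∞) ^ (finrank ℝ E + 1) * ∫⁻ y in B, ENNReal.ofReal (J y) ∧
        ∫⁻ y in B, ENNReal.ofReal (J y) ≤
          (c : ℝ≥0∞) ^ (finrank ℝ E + 1) * μHE[finrank ℝ E] (f '' B) := by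
      intro x
      by_cases hx : x ∈ U
      · obtain ⟨W, hW, h⟩ := eventually_measure_image_comparable (hf x hx) (hf' x hx)
          (hJf x hx) (hJ.continuousAt (hU.mem_nhds hx)) hc
        obtain ⟨V, hVW, hV, hxV⟩ := mem_nhds_iff.1 hW
        exact ⟨V, hV, fun _ => hxV, fun B hB => h B (hB.trans hVW)⟩
      · exact ⟨∅, isOpen_empty, fun h => absurd h hx, fun B hB _ => by
          rw [subset_empty_iff.1 hB]; simp⟩
    choose W hWo hWx hWm using hloc
    obtain ⟨s, -, hsc, hsU⟩ := TopologicalSpace.countable_cover_nhdsWithin (s := U) (f := W)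
      fun x hx => mem_nhdsWithin_of_mem_nhds ((hWo x).mem_nhds (hWx x hx))
    have hcov : ∃ V : ℕ → Set E, (∀ n, ∃ x, V n = W x) ∧ B ⊆ ⋃ n, V n := by
      rcases s.eq_empty_or_nonempty with rfl | hsne
      · refine ⟨fun _ => W 0, fun _ => ⟨0, rfl⟩, ?_⟩
        have : B ⊆ ∅ := hBU.trans (by simpa using hsU)
        exact this.trans (empty_subset _)
      · obtain ⟨u, hu⟩ := hsc.exists_eq_range hsne
        refine ⟨fun n => W (u n), fun n => ⟨_, rfl⟩, hBU.trans ?_⟩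
        simpa [hu] using hsU
    obtain ⟨V, hVW, hBV⟩ := hcov
    have hVo : ∀ n, MeasurableSet (V n) := fun n => by
      obtain ⟨x, hx⟩ := hVW n
      exact hx ▸ (hWo x).measurableSet
    -- Injectivity keeps the images of these disjoint pieces disjoint, so the local estimates add
    -- up.
    set D : ℕ → Set E := fun n => B ∩ disjointed V n with hD
    have hDm : ∀ n, MeasurableSet (D n) := fun n => hB.inter (.disjointed hVo n)
    have hDd : Pairwise (Function.onFun Disjoint D) := fun i j hij =>
      (disjoint_disjointed V hij).mono inter_subset_right inter_subset_right
    have hDB : B = ⋃ n, D n := by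
      rw [hD, ← inter_iUnion, iUnion_disjointed, inter_eq_left.2 hBV]
    have hDU : ∀ n, D n ⊆ U := fun n => inter_subset_left.trans hBU
    have hDV : ∀ n, D n ⊆ V n := fun n => inter_subset_right.trans (disjointed_subset V n)
    have e1 : μHE[finrank ℝ E] (f '' B) = ∑' n, μHE[finrank ℝ E] (f '' D n) := by
      rw [hDB, image_iUnion]
      refine measure_iUnion (fun i j hij => ?_) fun n =>
        (hDm n).image_of_continuousOn_injOn (hcont.mono (hDU n)) (hinj.mono (hDU n))
      exact disjoint_image_image fun x hx y hy h =>
        disjoint_left.1 (hDd hij) hx (hinj (hDU i hx) (hDU j hy) h ▸ hy)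
    have e2 : ∫⁻ y in B, ENNReal.ofReal (J y) = ∑' n, ∫⁻ y in D n, ENNReal.ofReal (J y) := by
      conv_lhs => rw [hDB]
      exact lintegral_iUnion hDm hDd _
    choose v hv using hVW
    have hn := fun n => hWm (v n) (D n) (hv n ▸ hDV n) (hDm n)
    rw [e1, e2, ← ENNReal.tsum_mul_left, ← ENNReal.tsum_mul_left]
    exact ⟨ENNReal.tsum_le_tsum fun n => (hn n).1, ENNReal.tsum_le_tsum fun n => (hn n).2⟩
  exact le_antisymm (ENNReal.le_of_forall_one_lt_pow_mul _ fun c hc => (key c hc).1)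
    (ENNReal.le_of_forall_one_lt_pow_mul _ fun c hc => (key c hc).2)

variable {f : E → F} {f' : E → E →L[ℝ] F} {U : Set E} {J : E → ℝ}

/-- The area formula as an identity of measures, from which integrability and integrals both
transfer. The subtype enters because only the restriction of `f` to `U` is a measurable embedding.
-/
lemma map_domRestrict_withDensity_normDet (hU : IsOpen U)
    (hf : ∀ x ∈ U, HasStrictFDerivAt f (f' x) x)
    (hf' : ∀ x ∈ U, Function.Injective (f' x)) (hinj : InjOn f U)
    (hJ : ContinuousOn J U) (hJf : ∀ x ∈ U, J x = (f' x).toLinearMap.normDet) :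
    Measure.map (U.domRestrict f)
      (comap (↑) (volume.withDensity fun x => ENNReal.ofReal (J x))) =
      (μHE[finrank ℝ E] : Measure F).restrict (f '' U) := by
  have hcont : ContinuousOn f U := fun x hx => (hf x hx).continuousAt.continuousWithinAt
  have hemb := hcont.measurableEmbedding hU.measurableSet hinj
  ext t ht
  rw [hemb.map_apply, comap_apply _ Subtype.val_injective
    (fun s hs => (MeasurableEmbedding.subtype_coe hU.measurableSet).measurableSet_image.2 hs) _
    (hemb.measurable ht), restrict_apply ht]
  have hset : Subtype.val '' (U.domRestrict f ⁻¹' t) = U ∩ f ⁻¹' t := by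
    ext x; simp [and_comm]
  have hm : MeasurableSet (U ∩ f ⁻¹' t) := by
    rw [← hset]
    exact (MeasurableEmbedding.subtype_coe hU.measurableSet).measurableSet_image.2
      (hemb.measurable ht)
  rw [hset, withDensity_apply _ hm, ← euclideanHausdorffMeasure_image_eq_lintegral_normDet hU hf
    hf' hinj hJ hJf hm inter_subset_left, image_inter_preimage, inter_comm]

/-- Area formula: integrability over the image of an injective immersion. -/
theorem integrableOn_image_iff_integrableOn_normDet (hU : IsOpen U)
    (hf : ∀ x ∈ U, HasStrictFDerivAt f (f' x) x)
    (hf' : ∀ x ∈ U, Function.Injective (f' x)) (hinj : InjOn f U)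
    (hJ : ContinuousOn J U) (hJf : ∀ x ∈ U, J x = (f' x).toLinearMap.normDet) (g : F → ℝ) :
    IntegrableOn g (f '' U) μHE[finrank ℝ E] ↔ IntegrableOn (fun x => J x * g (f x)) U := by
  have hcont : ContinuousOn f U := fun x hx => (hf x hx).continuousAt.continuousWithinAt
  rw [IntegrableOn, ← map_domRestrict_withDensity_normDet hU hf hf' hinj hJ hJf,
    (hcont.measurableEmbedding hU.measurableSet hinj).integrable_map_iff]
  simp only [Set.domRestrict_eq, ← Function.comp_assoc, ENNReal.ofReal]
  rw [← (MeasurableEmbedding.subtype_coe hU.measurableSet).integrable_map_iff,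
    map_comap_subtype_coe hU.measurableSet, restrict_withDensity hU.measurableSet,
    integrable_withDensity_iff_integrable_coe_smul₀]
  · refine integrableOn_congr_fun (fun x hx => ?_) hU.measurableSet
    have : 0 ≤ J x := by rw [hJf x hx]; exact LinearMap.normDet_nonneg _
    simp [Real.coe_toNNReal _ this]
  · exact (hJ.aemeasurable hU.measurableSet).real_toNNReal

/-- Area formula: integrals over the image of an injective immersion. -/
theorem integral_image_eq_integral_normDet (hU : IsOpen U)
    (hf : ∀ x ∈ U, HasStrictFDerivAt f (f' x) x)
    (hf' : ∀ x ∈ U, Function.Injective (f' x)) (hinj : InjOn f U)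
    (hJ : ContinuousOn J U) (hJf : ∀ x ∈ U, J x = (f' x).toLinearMap.normDet) (g : F → ℝ) :
    ∫ y in f '' U, g y ∂μHE[finrank ℝ E] = ∫ x in U, J x * g (f x) := by
  have hcont : ContinuousOn f U := fun x hx => (hf x hx).continuousAt.continuousWithinAt
  rw [← map_domRestrict_withDensity_normDet hU hf hf' hinj hJ hJf,
    (hcont.measurableEmbedding hU.measurableSet hinj).integral_map]
  simp only [Set.domRestrict_apply, ← Function.comp_apply (f := g), ENNReal.ofReal]
  rw [← (MeasurableEmbedding.subtype_coe hU.measurableSet).integral_map,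
    map_comap_subtype_coe hU.measurableSet,
    setIntegral_withDensity_eq_setIntegral_smul₀ _ _ hU.measurableSet]
  · refine setIntegral_congr_fun hU.measurableSet fun x hx => ?_
    have : 0 ≤ J x := by rw [hJf x hx]; exact LinearMap.normDet_nonneg _
    simp [NNReal.smul_def, Real.coe_toNNReal _ this]
  · exact (hJ.aemeasurable hU.measurableSet).real_toNNReal

end AreaFormula

/-! ### Cross product in coordinates -/

section CrossProduct

open scoped RealInnerProductSpace

@[simp] lemma cross_apply_zero (v w : E3) : cross v w 0 = v 1 * w 2 - v 2 * w 1 := by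
  simp [cross, crossProduct]

@[simp] lemma cross_apply_one (v w : E3) : cross v w 1 = v 2 * w 0 - v 0 * w 2 := by
  simp [cross, crossProduct]

@[simp] lemma cross_apply_two (v w : E3) : cross v w 2 = v 0 * w 1 - v 1 * w 0 := by
  simp [cross, crossProduct]

lemma E3.inner_eq (v w : E3) : ⟪v, w⟫ = v 0 * w 0 + v 1 * w 1 + v 2 * w 2 := by
  simp [PiLp.inner_apply, Fin.sum_univ_three, mul_comm]

lemma E3.norm_sq_eq (v : E3) : ‖v‖ ^ 2 = v 0 ^ 2 + v 1 ^ 2 + v 2 ^ 2 := by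
  rw [← real_inner_self_eq_norm_sq, E3.inner_eq]; ring

/-- The cross product as a continuous bilinear map. -/
def crossCLM : E3 →L[ℝ] E3 →L[ℝ] E3 :=
  LinearMap.toContinuousLinearMap
    ((LinearMap.toContinuousLinearMap (E := E3) (F' := E3)).toLinearMap ∘ₗ
      LinearMap.mk₂ ℝ cross
        (fun u v w => by ext i; fin_cases i <;> simp <;> ring)
        (fun c u v => by ext i; fin_cases i <;> simp <;> ring)
        (fun u v w => by ext i; fin_cases i <;> simp <;> ring)
        (fun c u v => by ext i; fin_cases i <;> simp <;> ring))

@[simp] lemma crossCLM_apply (v w : E3) : crossCLM v w = cross v w := rfl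

lemma ContDiffAt.cross {E : Type*} [NormedAddCommGroup E] [NormedSpace ℝ E] {u v : E → E3}
    {x : E} {n : WithTop ℕ∞} (hu : ContDiffAt ℝ n u x) (hv : ContDiffAt ℝ n v x) :
    ContDiffAt ℝ n (fun y => cross (u y) (v y)) x :=
  (crossCLM.contDiff.contDiffAt.comp x hu).clm_apply hv

lemma ContinuousOn.cross {E : Type*} [TopologicalSpace E] {u v : E → E3} {s : Set E}
    (hu : ContinuousOn u s) (hv : ContinuousOn v s) :
    ContinuousOn (fun y => cross (u y) (v y)) s :=
  (crossCLM.continuous.comp_continuousOn hu).clm_apply hv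

lemma fderiv_cross_apply {E : Type*} [NormedAddCommGroup E] [NormedSpace ℝ E] {u v : E → E3}
    {x : E} (hu : DifferentiableAt ℝ u x) (hv : DifferentiableAt ℝ v x) (z : E) :
    fderiv ℝ (fun y => cross (u y) (v y)) x z =
      cross (u x) (fderiv ℝ v x z) + cross (fderiv ℝ u x z) (v x) := by
  have := crossCLM.hasFDerivAt_of_bilinear hu.hasFDerivAt hv.hasFDerivAt
  have h2 := this.fderiv
  simp only [crossCLM_apply] at h2
  rw [h2]
  simp

end CrossProduct

/-! ### Geometry of a parametrized surface -/

section Parametrization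

open scoped RealInnerProductSpace

/-- The (non-normalized) normal `𝔤₁ × 𝔤₂` of a parametrization. -/
def normalVec (x : E2 → E3) (X : E2) : E3 := cross (tangentVec x 0 X) (tangentVec x 1 X)

/-- The derivative of `η` with respect to the coordinate `α`. -/
def coordDeriv {G : Type*} [NormedAddCommGroup G] [NormedSpace ℝ G] (η : E2 → G) (α : Fin 2)
    (X : E2) : G :=
  fderiv ℝ η X (EuclideanSpace.single α 1)

/-- The surface gradient of `η ∘ x⁻¹` at `x X`, as a function of the parameter `X`. -/
def pullGrad (x : E2 → E3) (η : E2 → ℝ) (X : E2) : E3 :=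
  (‖normalVec x X‖ ^ 2)⁻¹ •
    (coordDeriv η 0 X • cross (tangentVec x 1 X) (normalVec x X) +
      coordDeriv η 1 X • cross (normalVec x X) (tangentVec x 0 X))

lemma inner_pullGrad_normalVec (x : E2 → E3) (η : E2 → ℝ) (X : E2) :
    ⟪pullGrad x η X, normalVec x X⟫ = 0 := by
  rw [E3.inner_eq]
  simp [pullGrad]
  ring

lemma normalVec_ne_zero_of_sum_sq_pos {x : E2 → E3} {X : E2}
    (h : 0 < ∑ i : Fin 3, (cross (tangentVec x 0 X) (tangentVec x 1 X) i) ^ 2) :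
    normalVec x X ≠ 0 := by
  intro h0
  unfold normalVec at h0
  simp [h0] at h

lemma fderiv_apply_eq_tangentVec (x : E2 → E3) (X v : E2) :
    fderiv ℝ x X v = v 0 • tangentVec x 0 X + v 1 • tangentVec x 1 X := by
  have hv : v = v 0 • EuclideanSpace.single 0 (1 : ℝ) + v 1 • EuclideanSpace.single 1 (1 : ℝ) := by
    ext i; fin_cases i <;> simp
  conv_lhs => rw [hv]
  simp [tangentVec]

lemma fderiv_injective_of_normalVec_ne_zero {x : E2 → E3} {X : E2} (h : normalVec x X ≠ 0) :
    Function.Injective (fderiv ℝ x X) := by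
  rw [injective_iff_map_eq_zero]
  intro v hv
  rw [fderiv_apply_eq_tangentVec] at hv
  have h0 : v 0 • normalVec x X = 0 := by
    -- The cross product with one tangent vector isolates the coefficient of the other.
    have : cross (v 0 • tangentVec x 0 X + v 1 • tangentVec x 1 X) (tangentVec x 1 X) =
        v 0 • normalVec x X := by
      ext i; fin_cases i <;> simp [normalVec] <;> ring
    rw [← this, hv]; ext i; fin_cases i <;> simp
  have h1 : v 1 • normalVec x X = 0 := by
    have : cross (tangentVec x 0 X) (v 0 • tangentVec x 0 X + v 1 • tangentVec x 1 X) =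
        v 1 • normalVec x X := by
      ext i; fin_cases i <;> simp [normalVec] <;> ring
    rw [← this, hv]; ext i; fin_cases i <;> simp
  ext i
  fin_cases i
  · simpa [h] using h0
  · simpa [h] using h1

/-- Lagrange's identity: the Gram determinant of two vectors is the squared length of their cross
product. -/
lemma normDet_fderiv_eq_norm_normalVec (x : E2 → E3) (X : E2) :
    (fderiv ℝ x X).toLinearMap.normDet = ‖normalVec x X‖ := by
  have h := (fderiv ℝ x X).toLinearMap.normDet_sq_eq_det_gram (EuclideanSpace.basisFun (Fin 2) ℝ)
  rw [← sq_eq_sq₀ (LinearMap.normDet_nonneg _) (norm_nonneg _)]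
  simp only [RCLike.ofReal_real_eq_id, id] at h
  rw [h, Matrix.det_fin_two, E3.norm_sq_eq]
  simp only [Matrix.gram_apply, EuclideanSpace.basisFun_apply, ContinuousLinearMap.coe_coe]
  change ⟪tangentVec x 0 X, tangentVec x 0 X⟫ * ⟪tangentVec x 1 X, tangentVec x 1 X⟫ -
    ⟪tangentVec x 0 X, tangentVec x 1 X⟫ * ⟪tangentVec x 1 X, tangentVec x 0 X⟫ = _
  simp only [E3.inner_eq, normalVec, cross_apply_zero, cross_apply_one, cross_apply_two]
  ring

lemma ContDiff.tangentVec {x : E2 → E3} (hx : ContDiff ℝ 2 x) (α : Fin 2) :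
    ContDiff ℝ 1 (tangentVec x α) :=
  (hx.fderiv_right (m := 1) (by norm_num)).clm_apply contDiff_const

lemma ContDiff.normalVec {x : E2 → E3} (hx : ContDiff ℝ 2 x) : ContDiff ℝ 1 (normalVec x) :=
  contDiff_iff_contDiffAt.2 fun _ =>
    (hx.tangentVec 0).contDiffAt.cross (hx.tangentVec 1).contDiffAt

lemma continuousOn_pullGrad {x : E2 → E3} (hx : ContDiff ℝ 2 x) {η : E2 → ℝ}
    (hη : ContDiff ℝ 1 η) {s : Set E2} (hs : ∀ X ∈ s, normalVec x X ≠ 0) :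
    ContinuousOn (pullGrad x η) s := by
  have hd : ∀ α, ContinuousOn (coordDeriv η α) s := fun α =>
    ((hη.continuous_fderiv one_ne_zero).clm_apply continuous_const).continuousOn
  have hN := hx.normalVec.continuous.continuousOn (s := s)
  have h0 := (hx.tangentVec 0).continuous.continuousOn (s := s)
  have h1 := (hx.tangentVec 1).continuous.continuousOn (s := s)
  refine ContinuousOn.smul (ContinuousOn.inv₀ (hN.norm.pow 2) fun X hX => ?_)
    (((hd 0).smul (h1.cross hN)).add ((hd 1).smul (hN.cross h0)))
  simpa using hs X hX

end Parametrization

/-! ### Surface gradient in parameters and regularity of the flux -/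

namespace EvolvingSurface

variable {T : ℝ} (S : EvolvingSurface T)

lemma contDiff_param_time (t : ℝ) : ContDiff ℝ 2 (S.param t) :=
  S.contDiff_param.comp (contDiff_id.prodMk contDiff_const)

lemma normalVec_ne_zero {t : ℝ} (ht0 : 0 ≤ t) (htT : t < T) {X : E2} (hX : X ∈ closure S.U) :
    normalVec (S.param t) X ≠ 0 :=
  normalVec_ne_zero_of_sum_sq_pos (S.immersion t ht0 htT X hX)

variable {S} {t : ℝ}

lemma normal_param (hinj : InjOn (S.param t) S.U) {X : E2} (hX : X ∈ S.U) :
    S.normal t (S.param t X) = ‖normalVec (S.param t) X‖⁻¹ • normalVec (S.param t) X := by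
  have : Function.invFunOn (S.param t) S.U (S.param t X) = X :=
    hinj (Function.invFunOn_mem ⟨X, hX, rfl⟩) hX (Function.invFunOn_eq ⟨X, hX, rfl⟩)
  simp only [normal, this, normalVec]

/-- The derivative within the surface need not be unique, but the chain rule holds for whichever one
`fderivWithin` selects. -/
lemma hasFDerivAt_comp_param {G : Type*} [NormedAddCommGroup G] [NormedSpace ℝ G] {g : E3 → G}
    {X : E2} (hX : X ∈ S.U) (hg : DifferentiableWithinAt ℝ g (S.surface t) (S.param t X)) :
    HasFDerivAt (fun Y => g (S.param t Y))
      ((fderivWithin ℝ g (S.surface t) (S.param t X)).comp (fderiv ℝ (S.param t) X)) X := by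
  have hx : HasFDerivWithinAt (S.param t) (fderiv ℝ (S.param t) X) S.U X :=
    ((S.contDiff_param_time t).differentiable two_ne_zero X).hasFDerivAt.hasFDerivWithinAt
  exact (hg.hasFDerivWithinAt.comp X hx (mapsTo_image _ _)).hasFDerivAt (S.isOpen_U.mem_nhds hX)

/-- The surface gradient in terms of the parametrization. -/
lemma grad_param (hinj : InjOn (S.param t) S.U) {X : E2} (hX : X ∈ S.U)
    (hN : normalVec (S.param t) X ≠ 0) {g : E3 → ℝ}
    (hg : DifferentiableWithinAt ℝ g (S.surface t) (S.param t X)) :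
    S.grad t g (S.param t X) = pullGrad (S.param t) (fun Y => g (S.param t Y)) X := by
  have hD := (hasFDerivAt_comp_param hX hg).fderiv
  set L := fderivWithin ℝ g (S.surface t) (S.param t X) with hL
  have hLv : ∀ v : E3, L v = v 0 * L (EuclideanSpace.single 0 1) +
      v 1 * L (EuclideanSpace.single 1 1) + v 2 * L (EuclideanSpace.single 2 1) := by
    intro v
    have hv : v = v 0 • EuclideanSpace.single 0 (1 : ℝ) + v 1 • EuclideanSpace.single 1 (1 : ℝ) +
        v 2 • EuclideanSpace.single 2 (1 : ℝ) := by
      ext i; fin_cases i <;> simp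
    conv_lhs => rw [hv]
    simp
  have hc : ∀ α, coordDeriv (fun Y => g (S.param t Y)) α X = L (tangentVec (S.param t) α X) := by
    intro α
    simp [coordDeriv, hD, tangentVec]
  have hJ : (0 : ℝ) < ‖normalVec (S.param t) X‖ := norm_pos_iff.2 hN
  have hJ2 := E3.norm_sq_eq (normalVec (S.param t) X)
  ext j
  simp only [grad, tderiv, normal_param hinj hX, pullGrad, hc, ← hL]
  rw [hLv (tangentVec _ 0 X), hLv (tangentVec _ 1 X)]
  simp only [Fin.sum_univ_three, PiLp.smul_apply, PiLp.add_apply, smul_eq_mul]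
  generalize L (EuclideanSpace.single 0 1) = l0 at *
  generalize L (EuclideanSpace.single 1 1) = l1 at *
  generalize L (EuclideanSpace.single 2 1) = l2 at *
  have hNdef : normalVec (S.param t) X =
    cross (tangentVec (S.param t) 0 X) (tangentVec (S.param t) 1 X) := rfl
  generalize tangentVec (S.param t) 0 X = a at *
  generalize tangentVec (S.param t) 1 X = b at *
  generalize ‖normalVec (S.param t) X‖ = J at *
  rw [hNdef] at hJ2 ⊢
  have hJ2' : (J : ℝ) ^ 2 ≠ 0 := by positivity
  -- With `N = a × b` this is the identity `|N|² l - (N·l) N = (l·a) b × N + (l·b) N × a`,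
  -- componentwise.
  fin_cases j <;> simp at hJ2 ⊢ <;> field_simp <;> rw [hJ2] <;> ring

lemma tderiv_param (hinj : InjOn (S.param t) S.U) {X : E2} (hX : X ∈ S.U)
    (hN : normalVec (S.param t) X ≠ 0) {g : E3 → ℝ}
    (hg : DifferentiableWithinAt ℝ g (S.surface t) (S.param t X)) (j : Fin 3) :
    S.tderiv t j g (S.param t X) = pullGrad (S.param t) (fun Y => g (S.param t Y)) X j :=
  congrArg (fun v : E3 => v j) (grad_param hinj hX hN hg)

end EvolvingSurface

lemma pullGrad_congr {x : E2 → E3} {η ζ : E2 → ℝ} {X : E2} (h : η =ᶠ[𝓝 X] ζ) :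
    pullGrad x η X = pullGrad x ζ X := by
  simp only [pullGrad, coordDeriv, h.fderiv_eq]

lemma contDiffAt_pullGrad {x : E2 → E3} (hx : ContDiff ℝ 2 x) {η : E2 → ℝ}
    (hη : ContDiff ℝ 2 η) {X : E2} (hX : normalVec x X ≠ 0) :
    ContDiffAt ℝ 1 (pullGrad x η) X := by
  have hd : ∀ α, ContDiffAt ℝ 1 (coordDeriv η α) X := fun α =>
    ((hη.fderiv_right (m := 1) (by norm_num)).clm_apply contDiff_const).contDiffAt
  have hN := hx.normalVec.contDiffAt (x := X)
  have h0 := (hx.tangentVec 0).contDiffAt (x := X)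
  have h1 := (hx.tangentVec 1).contDiffAt (x := X)
  exact ((hN.norm_sq ℝ).inv (by simpa using hX)).smul
    (((hd 0).smul (h1.cross hN)).add ((hd 1).smul (hN.cross h0)))

/-- An immersion has a local left inverse defined on a neighbourhood in the target space. -/
lemma exists_contDiffAt_local_leftInverse {E F : Type*} [NormedAddCommGroup E] [NormedSpace ℝ E]
    [FiniteDimensional ℝ E] [NormedAddCommGroup F] [NormedSpace ℝ F] [FiniteDimensional ℝ F]
    {x : E → F} {X : E} {n : WithTop ℕ∞} (hn : n ≠ 0) (hx : ContDiffAt ℝ n x X)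
    (hA : Function.Injective (fderiv ℝ x X)) :
    ∃ l : F → E, ContDiffAt ℝ n l (x X) ∧ ∀ᶠ Y in 𝓝 X, l (x Y) = Y := by
  have : CompleteSpace E := FiniteDimensional.complete ℝ E
  -- Composing `x` with a linear left inverse `P` of its derivative makes the derivative the
  -- identity; the inverse function theorem then applies to `P ∘ x`.
  obtain ⟨p, hp⟩ := (fderiv ℝ x X).toLinearMap.exists_leftInverse_of_injective
    (LinearMap.ker_eq_bot.2 hA)
  set P : F →L[ℝ] E := LinearMap.toContinuousLinearMap p
  have hPx : ContDiffAt ℝ n (fun Y => P (x Y)) X := P.contDiff.contDiffAt.comp X hx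
  have hd : HasFDerivAt (fun Y => P (x Y)) (ContinuousLinearEquiv.refl ℝ E : E →L[ℝ] E) X := by
    have h := P.hasFDerivAt.comp X (hx.differentiableAt hn).hasFDerivAt
    have heq : P.comp (fderiv ℝ x X) = (ContinuousLinearEquiv.refl ℝ E : E →L[ℝ] E) := by
      ext v
      exact congrArg (fun φ : E →ₗ[ℝ] E => φ v) hp
    rwa [heq] at h
  have hl := hPx.to_localInverse hd hn
  refine ⟨fun y => hPx.localInverse hd hn (P y), ?_, ?_⟩
  · exact hl.comp (x X) P.contDiff.contDiffAt
  · exact (hPx.hasStrictFDerivAt' hd hn).eventually_left_inverse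

namespace EvolvingSurface

variable {T : ℝ} {S : EvolvingSurface T} {t : ℝ}

lemma isCompact_closure_U (S : EvolvingSurface T) : IsCompact (closure S.U) :=
  S.isBounded_U.isCompact_closure

/-- Away from its boundary the surface is embedded: points of the surface close to `x X` have
parameters close to `X`. -/
lemma nhdsWithin_surface_le_map (hinj : InjOn (S.param t) S.U) {X : E2} (hX : X ∈ S.U)
    (hb : S.param t X ∉ S.bdry t) :
    𝓝[S.surface t] (S.param t X) ≤ map (S.param t) (𝓝[S.U] X) := by
  have hcont : Continuous (S.param t) := (S.contDiff_param_time t).continuous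
  intro W hW
  obtain ⟨V, hV, hXV, hVW⟩ := mem_nhdsWithin.1 hW
  -- Parameters outside `V` have a compact image. It misses the given point: in `U` by injectivity,
  -- on the frontier because the point is not in `∂Γ(t)`.
  have hK : IsClosed (S.param t '' (closure S.U \ V)) :=
    ((S.isCompact_closure_U.diff hV).image hcont).isClosed
  have hn : S.param t X ∉ S.param t '' (closure S.U \ V) := by
    rintro ⟨Y, ⟨hYU, hYV⟩, hY⟩
    by_cases hYi : Y ∈ S.U
    · exact hYV (hinj hYi hX hY ▸ hXV)
    · refine hb ⟨Y, ?_, hY⟩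
      rw [S.isOpen_U.frontier_eq]
      exact ⟨hYU, hYi⟩
  filter_upwards [mem_nhdsWithin_of_mem_nhds (hK.isOpen_compl.mem_nhds hn),
    self_mem_nhdsWithin] with y hy hyS
  obtain ⟨Y, hY, rfl⟩ := hyS
  have hYV : Y ∈ V := by
    by_contra h
    exact hy ⟨Y, ⟨subset_closure hY, h⟩, rfl⟩
  exact hVW ⟨hYV, hY⟩

lemma differentiableWithinAt_of_eqOn {g F : E3 → ℝ} (hF : Differentiable ℝ F)
    (h : EqOn g F (S.surface t)) {X : E2} (hX : X ∈ S.U) :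
    DifferentiableWithinAt ℝ g (S.surface t) (S.param t X) :=
  (hF _).differentiableWithinAt.congr h (h ⟨X, hX, rfl⟩)

lemma grad_param_of_eqOn (hinj : InjOn (S.param t) S.U) {X : E2} (hX : X ∈ S.U)
    (hN : normalVec (S.param t) X ≠ 0) {g F : E3 → ℝ} (hF : Differentiable ℝ F)
    (h : EqOn g F (S.surface t)) :
    S.grad t g (S.param t X) = pullGrad (S.param t) (fun Y => F (S.param t Y)) X := by
  rw [grad_param hinj hX hN (differentiableWithinAt_of_eqOn hF h hX)]
  refine pullGrad_congr ?_
  filter_upwards [S.isOpen_U.mem_nhds hX] with Y hY using h ⟨Y, hY, rfl⟩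

/-- The flux is `C¹` off the boundary if the energy density is `C²`. -/
theorem isC1OffBdry_flux (ht0 : 0 ≤ t) (htT : t < T) (hinj : InjOn (S.param t) S.U)
    {e : ℝ → ℝ} (he : ContDiffOn ℝ 2 e (Ici 0)) {f : E3 → ℝ} (hf : S.IsCk t 2 f) :
    S.IsC1OffBdry t (S.flux t e f) := by
  obtain ⟨F, hF, hfF⟩ := hf
  replace hF : ContDiff ℝ 2 F := by exact_mod_cast hF
  rintro _ ⟨⟨X, hX, rfl⟩, hb⟩
  have hx := S.contDiff_param_time t
  have hN : ∀ Y ∈ S.U, normalVec (S.param t) Y ≠ 0 := fun Y hY =>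
    S.normalVec_ne_zero ht0 htT (subset_closure hY)
  obtain ⟨l, hl, hlx⟩ := exists_contDiffAt_local_leftInverse two_ne_zero (hx.contDiffAt (x := X))
    (fderiv_injective_of_normalVec_ne_zero (hN X hX))
  set G := pullGrad (S.param t) (fun Y => F (S.param t Y)) with hG
  -- The extension off the surface reads the parameter from the local left inverse `l`.
  refine ⟨fun y => derivWithin e (Ici 0) (‖G (l y)‖ ^ 2) • G (l y), ?_, ?_⟩
  · have hGl : ContDiffAt ℝ 1 (fun y => G (l y)) (S.param t X) := by
      have hGX : ContDiffAt ℝ 1 G (l (S.param t X)) := by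
        rw [hlx.self_of_nhds]
        exact contDiffAt_pullGrad hx (hF.comp hx) (hN X hX)
      exact hGX.comp (S.param t X) (hl.of_le (m := 1) (by norm_num))
    have he' : ContDiffOn ℝ 1 (derivWithin e (Ici 0)) (Ici 0) :=
      he.derivWithin (uniqueDiffOn_Ici 0) (by norm_num)
    have hel : ContDiffAt ℝ 1 (fun y => derivWithin e (Ici 0) (‖G (l y)‖ ^ 2)) (S.param t X) :=
      contDiffWithinAt_univ.1 ((he' (‖G (l (S.param t X))‖ ^ 2) (sq_nonneg ‖G (l (S.param t X))‖)).comp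
        (f := fun y => ‖G (l y)‖ ^ 2) (S.param t X)
        (hGl.norm_sq ℝ).contDiffWithinAt fun y _ => sq_nonneg ‖G (l y)‖)
    exact hel.smul hGl
  · refine nhdsWithin_surface_le_map hinj hX hb (mem_map.2 ?_)
    filter_upwards [self_mem_nhdsWithin, mem_nhdsWithin_of_mem_nhds hlx] with Y hY hlY
    simp only [mem_preimage, mem_ofPred_eq]
    rw [flux, grad_param_of_eqOn hinj hY (hN Y hY) (hF.differentiable two_ne_zero)
      (hfF.mono subset_closure), hlY]

end EvolvingSurface

/-! ### Surface divergence and integration by parts -/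

section Divergence

open scoped RealInnerProductSpace

lemma coordDeriv_mul {u v : E2 → ℝ} {X : E2} (hu : DifferentiableAt ℝ u X)
    (hv : DifferentiableAt ℝ v X) (α : Fin 2) :
    coordDeriv (fun Y => u Y * v Y) α X = u X * coordDeriv v α X + coordDeriv u α X * v X := by
  simp only [coordDeriv]
  rw [fderiv_fun_mul hu hv]
  simp [mul_comm]

lemma coordDeriv_inner {u v : E2 → E3} {X : E2} (hu : DifferentiableAt ℝ u X)
    (hv : DifferentiableAt ℝ v X) (α : Fin 2) :
    coordDeriv (fun Y => ⟪u Y, v Y⟫) α X = ⟪u X, coordDeriv v α X⟫ + ⟪coordDeriv u α X, v X⟫ := by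
  simp only [coordDeriv]
  rw [fderiv_inner_apply ℝ hu hv]

lemma coordDeriv_cross {u v : E2 → E3} {X : E2} (hu : DifferentiableAt ℝ u X)
    (hv : DifferentiableAt ℝ v X) (α : Fin 2) :
    coordDeriv (fun Y => cross (u Y) (v Y)) α X =
      cross (u X) (coordDeriv v α X) + cross (coordDeriv u α X) (v X) :=
  fderiv_cross_apply hu hv _

lemma coordDeriv_component {u : E2 → E3} {X : E2} (hu : DifferentiableAt ℝ u X) (α : Fin 2)
    (j : Fin 3) : coordDeriv (fun Y => u Y j) α X = coordDeriv u α X j := by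
  have h := ((EuclideanSpace.proj j : E3 →L[ℝ] ℝ).hasFDerivAt.comp X
    hu.hasFDerivAt).fderiv
  have h' : fderiv ℝ (fun Y => u Y j) X = _ := h
  simp [coordDeriv, h']

lemma coordDeriv_tangentVec_comm {x : E2 → E3} (hx : ContDiff ℝ 2 x) (X : E2) :
    coordDeriv (tangentVec x 1) 0 X = coordDeriv (tangentVec x 0) 1 X := by
  have hd : DifferentiableAt ℝ (fderiv ℝ x) X :=
    ((hx.fderiv_right (m := 1) (by norm_num)).differentiable one_ne_zero) X
  have h : ∀ α β, coordDeriv (tangentVec x α) β X =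
      fderiv ℝ (fderiv ℝ x) X (EuclideanSpace.single β 1) (EuclideanSpace.single α 1) := by
    intro α β
    have := (hd.hasFDerivAt.clm_apply
      (hasFDerivAt_const (EuclideanSpace.single α (1 : ℝ) : E2) X)).fderiv
    have h' : fderiv ℝ (tangentVec x α) X = _ := this
    simp [coordDeriv, h']
  rw [h, h]
  exact (hx.contDiffAt.isSymmSndFDerivAt (by simp)) _ _

/-- The unit normal of a parametrization. -/
def unitNormalVec (x : E2 → E3) (X : E2) : E3 := ‖normalVec x X‖⁻¹ • normalVec x X

/-- The contravariant components, multiplied by the area density, of a tangential vector field. -/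
def densityComp (x : E2 → E3) (φ : E2 → E3) (α : Fin 2) (X : E2) : ℝ :=
  if α = 0 then ⟪cross (φ X) (tangentVec x 1 X), unitNormalVec x X⟫
  else ⟪cross (tangentVec x 0 X) (φ X), unitNormalVec x X⟫

variable {x : E2 → E3} {X : E2}

lemma contDiffAt_unitNormalVec (hx : ContDiff ℝ 2 x) (hN : normalVec x X ≠ 0) :
    ContDiffAt ℝ 1 (unitNormalVec x) X :=
  have hN' := hx.normalVec.contDiffAt (x := X)
  ((hN'.norm ℝ hN).inv (by simpa using hN)).smul hN'

lemma contDiffAt_densityComp (hx : ContDiff ℝ 2 x) (hN : normalVec x X ≠ 0) {φ : E2 → E3}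
    (hφ : ContDiffAt ℝ 1 φ X) (α : Fin 2) : ContDiffAt ℝ 1 (densityComp x φ α) X := by
  have hn := contDiffAt_unitNormalVec hx hN
  fin_cases α
  · exact (hφ.cross (hx.tangentVec 1).contDiffAt).inner ℝ hn
  · exact ((hx.tangentVec 0).contDiffAt.cross hφ).inner ℝ hn

/-- Both `u` and `v` lie in the plane orthogonal to `n`, so their cross product is parallel to `n`.
The identity `key` is the linear relation between four vectors of `ℝ³`, paired with `n`. -/
lemma inner_cross_eq_zero_of_orthogonal {u v n m : E3} (hn : ⟪n, n⟫ = 1) (hu : ⟪u, n⟫ = 0)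
    (hv : ⟪v, n⟫ = 0) (hm : ⟪n, m⟫ = 0) : ⟪cross u v, m⟫ = 0 := by
  have key : ⟪cross u v, m⟫ * ⟪n, n⟫ = ⟪cross u v, n⟫ * ⟪n, m⟫ + ⟪u, n⟫ * ⟪cross n v, m⟫ -
      ⟪v, n⟫ * ⟪cross n u, m⟫ := by
    simp only [E3.inner_eq, cross_apply_zero, cross_apply_one, cross_apply_two]
    ring
  rw [hn, hu, hv, hm] at key
  simpa using key

lemma inner_unitNormalVec_self (hN : normalVec x X ≠ 0) :
    ⟪unitNormalVec x X, unitNormalVec x X⟫ = 1 := by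
  have : ‖normalVec x X‖ ≠ 0 := by simpa using hN
  rw [real_inner_self_eq_norm_sq, unitNormalVec, norm_smul]
  simp [this]

/-- The coordinate expression of the surface divergence of a tangential field. -/
lemma sum_coordDeriv_densityComp (hx : ContDiff ℝ 2 x) (hN : normalVec x X ≠ 0) {φ : E2 → E3}
    (hφ : DifferentiableAt ℝ φ X) (hφN : ⟪φ X, normalVec x X⟫ = 0) :
    coordDeriv (densityComp x φ 0) 0 X + coordDeriv (densityComp x φ 1) 1 X =
      ‖normalVec x X‖ * ∑ j, pullGrad x (fun Y => φ Y j) X j := by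
  have hn := (contDiffAt_unitNormalVec hx hN).differentiableAt one_ne_zero
  have hg : ∀ α, DifferentiableAt ℝ (tangentVec x α) X := fun α =>
    (hx.tangentVec α).differentiable one_ne_zero X
  have hc0 : DifferentiableAt ℝ (fun Y => cross (φ Y) (tangentVec x 1 Y)) X :=
    (crossCLM.differentiableAt.comp X hφ).clm_apply (hg 1)
  have hc1 : DifferentiableAt ℝ (fun Y => cross (tangentVec x 0 Y) (φ Y)) X :=
    (crossCLM.differentiableAt.comp X (hg 0)).clm_apply hφ
  have hnn : ∀ α, ⟪unitNormalVec x X, coordDeriv (unitNormalVec x) α X⟫ = 0 := by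
    intro α
    have h1 := coordDeriv_inner hn hn α
    have h2 : (fun Y => ⟪unitNormalVec x Y, unitNormalVec x Y⟫) =ᶠ[𝓝 X] fun _ => (1 : ℝ) := by
      filter_upwards [hx.normalVec.continuous.continuousAt.eventually_ne hN] with Y hY
      exact inner_unitNormalVec_self hY
    rw [coordDeriv, h2.fderiv_eq, real_inner_comm] at h1
    simp only [fderiv_fun_const, Pi.zero_apply, zero_apply] at h1
    rw [real_inner_comm]
    linarith
  have hφn : ⟪φ X, unitNormalVec x X⟫ = 0 := by
    rw [unitNormalVec, real_inner_smul_right, hφN, mul_zero]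
  have hgn : ∀ α, ⟪tangentVec x α X, unitNormalVec x X⟫ = 0 := by
    intro α
    rw [unitNormalVec, real_inner_smul_right]
    have : ⟪tangentVec x α X, normalVec x X⟫ = 0 := by
      fin_cases α <;> simp [E3.inner_eq, normalVec] <;> ring
    rw [this, mul_zero]
  have e0 : coordDeriv (densityComp x φ 0) 0 X = _ := coordDeriv_inner hc0 hn 0
  have e1 : coordDeriv (densityComp x φ 1) 1 X = _ := coordDeriv_inner hc1 hn 1
  -- The derivatives of the unit normal are tangential, so their terms vanish; the second
  -- derivatives of `x` are symmetric, so their terms cancel by antisymmetry of the cross product.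
  rw [e0, e1, coordDeriv_cross hφ (hg 1), coordDeriv_cross (hg 0) hφ,
    coordDeriv_tangentVec_comm hx,
    inner_cross_eq_zero_of_orthogonal (inner_unitNormalVec_self hN) hφn (hgn 1) (hnn 0),
    inner_cross_eq_zero_of_orthogonal (inner_unitNormalVec_self hN) (hgn 0) hφn (hnn 1)]
  have hJ : ‖normalVec x X‖ ≠ 0 := by simpa using hN
  simp only [pullGrad, coordDeriv_component hφ, unitNormalVec, Fin.sum_univ_three, E3.inner_eq,
    PiLp.smul_apply, PiLp.add_apply, smul_eq_mul, cross_apply_zero, cross_apply_one,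
    cross_apply_two]
  field_simp
  ring

/-- The directional derivative along a tangential field in coordinates. -/
lemma sum_densityComp_mul_coordDeriv (hN : normalVec x X ≠ 0) (φ : E2 → E3) (η : E2 → ℝ) :
    densityComp x φ 0 X * coordDeriv η 0 X + densityComp x φ 1 X * coordDeriv η 1 X =
      ‖normalVec x X‖ * ⟪φ X, pullGrad x η X⟫ := by
  have hJ : ‖normalVec x X‖ ≠ 0 := by simpa using hN
  simp only [pullGrad, densityComp, unitNormalVec, E3.inner_eq, if_true, one_ne_zero, if_false,
    PiLp.smul_apply, PiLp.add_apply, smul_eq_mul, cross_apply_zero, cross_apply_one,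
    cross_apply_two]
  field_simp
  ring

/-- Integration by parts against the constant `1`. -/
lemma integral_coordDeriv_eq_zero {W : E2 → ℝ} (hW : ContDiff ℝ 1 W) (hc : HasCompactSupport W)
    (α : Fin 2) : Integrable (coordDeriv W α) ∧ ∫ X, coordDeriv W α X = 0 := by
  have hi : Integrable (coordDeriv W α) :=
    ((hW.continuous_fderiv one_ne_zero).clm_apply continuous_const).integrable_of_hasCompactSupport
      (hc.fderiv_apply ℝ _)
  have h := integral_mul_fderiv_eq_neg_fderiv_mul_of_integrable (μ := (volume : Measure E2))
    (f := fun _ : E2 => (1 : ℝ)) (g := W) (v := EuclideanSpace.single α 1) (by simp)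
    (by simp only [one_mul]; exact hi) (by simpa using hW.continuous.integrable_of_hasCompactSupport hc)
    (fun _ _ => differentiableAt_const _) (fun _ _ => hW.differentiable one_ne_zero _)
  refine ⟨hi, ?_⟩
  simpa [coordDeriv] using h

lemma contDiff_of_forall_mem_tsupport {W : E2 → ℝ} {n : WithTop ℕ∞}
    (h : ∀ X ∈ tsupport W, ContDiffAt ℝ n W X) : ContDiff ℝ n W :=
  contDiff_iff_contDiffAt.2 fun X => by
    by_cases hX : X ∈ tsupport W
    · exact h X hX
    · exact (contDiffAt_const (c := (0 : ℝ))).congr_of_eventuallyEq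
        (notMem_tsupport_iff_eventuallyEq.1 hX)

/-- Divergence theorem on a parametrized surface, for a tangential field and a test function with
compact support. -/
theorem integral_inner_pullGrad_eq_neg_integral_div (hx : ContDiff ℝ 2 x) {φ : E2 → E3}
    {η : E2 → ℝ} (hη : ContDiff ℝ 1 η) (hc : HasCompactSupport η)
    (hN : ∀ X ∈ tsupport η, normalVec x X ≠ 0) (hφ : ∀ X ∈ tsupport η, ContDiffAt ℝ 1 φ X)
    (hφN : ∀ X ∈ tsupport η, ⟪φ X, normalVec x X⟫ = 0) :
    Integrable (fun X => ‖normalVec x X‖ * ((∑ j, pullGrad x (fun Y => φ Y j) X j) * η X)) ∧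
      ∫ X, ‖normalVec x X‖ * ⟪φ X, pullGrad x η X⟫ =
        -∫ X, ‖normalVec x X‖ * ((∑ j, pullGrad x (fun Y => φ Y j) X j) * η X) := by
  set W : Fin 2 → E2 → ℝ := fun α X => densityComp x φ α X * η X with hWdef
  have hWt : ∀ α, tsupport (W α) ⊆ tsupport η := fun α => tsupport_mul_subset_right
  have hWc : ∀ α, HasCompactSupport (W α) := fun α => hc.mul_left
  have hW : ∀ α, ContDiff ℝ 1 (W α) := fun α => contDiff_of_forall_mem_tsupport fun X hX =>
    (contDiffAt_densityComp hx (hN X (hWt α hX)) (hφ X (hWt α hX)) α).mul hη.contDiffAt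
  have hI := fun α => integral_coordDeriv_eq_zero (hW α) (hWc α) α
  have hgrad : ∀ X ∉ tsupport η, pullGrad x η X = 0 := fun X hX => by
    have h0 := notMem_tsupport_iff_eventuallyEq.1 hX
    rw [pullGrad_congr h0]
    simp [pullGrad, coordDeriv, show (0 : E2 → ℝ) = fun _ => 0 from rfl]
  have hpt : ∀ X, coordDeriv (W 0) 0 X + coordDeriv (W 1) 1 X =
      ‖normalVec x X‖ * ⟪φ X, pullGrad x η X⟫ +
        ‖normalVec x X‖ * ((∑ j, pullGrad x (fun Y => φ Y j) X j) * η X) := by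
    intro X
    by_cases hX : X ∈ tsupport η
    · have hd : ∀ α, DifferentiableAt ℝ (densityComp x φ α) X := fun α =>
        (contDiffAt_densityComp hx (hN X hX) (hφ X hX) α).differentiableAt one_ne_zero
      have hηd := hη.differentiable one_ne_zero X
      rw [hWdef]
      simp only [coordDeriv_mul (hd _) hηd]
      rw [← sum_densityComp_mul_coordDeriv (hN X hX), ← mul_assoc,
        ← sum_coordDeriv_densityComp hx (hN X hX) ((hφ X hX).differentiableAt one_ne_zero)
          (hφN X hX)]
      ring
    · have h0 : ∀ α, coordDeriv (W α) α X = 0 := fun α => by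
        have := notMem_tsupport_iff_eventuallyEq.1 fun h => hX (hWt α h)
        simp [coordDeriv, this.fderiv_eq, show (0 : E2 → ℝ) = fun _ => 0 from rfl]
      rw [h0, h0, hgrad X hX, image_eq_zero_of_notMem_tsupport hX]
      simp
  have hi1 : Integrable (fun X => ‖normalVec x X‖ * ⟪φ X, pullGrad x η X⟫) := by
    refine Continuous.integrable_of_hasCompactSupport ?_ ?_
    · refine continuous_of_tsupport fun X hX => ?_
      have hX' : X ∈ tsupport η := by
        by_contra h
        refine notMem_tsupport_iff_eventuallyEq.2 ?_ hX
        filter_upwards [(isClosed_tsupport η).isOpen_compl.mem_nhds h] with Y hY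
        simp [hgrad Y hY]
      have hN' : ∀ᶠ Y in 𝓝 X, normalVec x Y ≠ 0 :=
        hx.normalVec.continuous.continuousAt.eventually_ne (hN X hX')
      exact hx.normalVec.continuous.norm.continuousAt.mul
        ((hφ X hX').continuousAt.inner
          ((continuousOn_pullGrad hx hη (fun Y hY => hY)).continuousAt hN'))
    · exact HasCompactSupport.intro hc fun X hX => by simp [hgrad X hX]
  have hsum : Integrable fun X => coordDeriv (W 0) 0 X + coordDeriv (W 1) 1 X :=
    (hI 0).1.add (hI 1).1
  -- The divergence term is the difference of two functions already known to be integrable.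
  have hi2 : Integrable
      (fun X => ‖normalVec x X‖ * ((∑ j, pullGrad x (fun Y => φ Y j) X j) * η X)) := by
    refine (hsum.sub hi1).congr (Eventually.of_forall fun X => ?_)
    simp [hpt X]
  refine ⟨hi2, ?_⟩
  have h1 : ∫ X, (coordDeriv (W 0) 0 X + coordDeriv (W 1) 1 X) = 0 := by
    rw [integral_add (hI 0).1 (hI 1).1, (hI 0).2, (hI 1).2, add_zero]
  simp only [hpt] at h1
  rw [integral_add hi1 hi2] at h1
  linarith

end Divergence

/-! ### Differentiation under the integral sign -/

open scoped RealInnerProductSpace in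
/-- Differentiation of the energy under the integral sign. -/
lemma hasDerivAt_integral_energy_density {U : Set E2} (hU : MeasurableSet U)
    (hK : IsCompact (closure U)) {e : ℝ → ℝ} (he : ContDiffOn ℝ 1 e (Ici 0)) {a b : E2 → E3}
    {J : E2 → ℝ} (ha : ContinuousOn a (closure U)) (hb : ContinuousOn b (closure U))
    (hJ : ContinuousOn J (closure U)) :
    (∀ ε : ℝ, IntegrableOn (fun X => J X * (1 / 2 * e (‖a X + ε • b X‖ ^ 2))) U) ∧
    HasDerivAt (fun ε : ℝ => ∫ X in U, J X * (1 / 2 * e (‖a X + ε • b X‖ ^ 2)))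
      (∫ X in U, J X * ⟪derivWithin e (Ici 0) (‖a X‖ ^ 2) • a X, b X⟫) 0 := by
  have hab : ContinuousOn (fun p : ℝ × E2 => a p.2 + p.1 • b p.2) (univ ×ˢ closure U) :=
    (ha.comp continuousOn_snd fun p hp => hp.2).add
      (continuousOn_fst.smul (hb.comp continuousOn_snd fun p hp => hp.2))
  have hmaps : MapsTo (fun p : ℝ × E2 => ‖a p.2 + p.1 • b p.2‖ ^ 2) (univ ×ˢ closure U)
      (Ici 0) := fun p _ => sq_nonneg ‖a p.2 + p.1 • b p.2‖
  have hcF : ContinuousOn (fun p : ℝ × E2 => J p.2 * (1 / 2 * e (‖a p.2 + p.1 • b p.2‖ ^ 2)))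
      (univ ×ˢ closure U) :=
    (hJ.comp continuousOn_snd fun p hp => hp.2).mul
      (continuousOn_const.mul (he.continuousOn.comp (hab.norm.pow 2) hmaps))
  have he' : ContinuousOn (derivWithin e (Ici 0)) (Ici 0) :=
    he.continuousOn_derivWithin (uniqueDiffOn_Ici 0) le_rfl
  set F' : ℝ → E2 → ℝ := fun ε X => J X *
    (derivWithin e (Ici 0) (‖a X + ε • b X‖ ^ 2) * ⟪a X + ε • b X, b X⟫) with hF'
  have hcF' : ContinuousOn (fun p : ℝ × E2 => F' p.1 p.2) (univ ×ˢ closure U) :=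
    (hJ.comp continuousOn_snd fun p hp => hp.2).mul
      ((he'.comp (hab.norm.pow 2) hmaps).mul
        (hab.inner (hb.comp continuousOn_snd fun p hp => hp.2)))
  have hslice : ∀ ε : ℝ, ContinuousOn (fun X : E2 => (ε, X)) (closure U) := fun ε =>
    (Continuous.prodMk_right ε).continuousOn
  have hint : ∀ ε : ℝ, IntegrableOn (fun X => J X * (1 / 2 * e (‖a X + ε • b X‖ ^ 2))) U :=
    fun ε => ((hcF.comp (hslice ε) fun X hX => ⟨mem_univ _, hX⟩).integrableOn_compact hK).mono_set
      subset_closure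
  refine ⟨hint, ?_⟩
  -- Joint continuity on a compact product gives a constant dominating function.
  obtain ⟨C, hC⟩ := ((isCompact_Icc (a := (-1 : ℝ)) (b := 1)).prod hK).exists_bound_of_continuousOn
    (hcF'.mono (prod_mono (subset_univ _) subset_rfl))
  have hfin : IsFiniteMeasure (volume.restrict U : Measure E2) :=
    ⟨by simpa using (measure_mono subset_closure).trans_lt hK.measure_lt_top⟩
  have h := hasDerivAt_integral_of_dominated_loc_of_deriv_le (μ := volume.restrict U)
    (F := fun (ε : ℝ) X => J X * (1 / 2 * e (‖a X + ε • b X‖ ^ 2))) (F' := F') (x₀ := 0)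
    (s := Icc (-1) 1) (bound := fun _ => C) (Icc_mem_nhds (by norm_num) (by norm_num))
    (Eventually.of_forall fun ε => (hint ε).aestronglyMeasurable) (hint 0)
    (((hcF'.comp (hslice 0) fun X hX => ⟨mem_univ _, hX⟩).mono
      subset_closure).aestronglyMeasurable hU)
    ((ae_restrict_mem hU).mono fun X hX ε hε => hC (ε, X) ⟨hε, subset_closure hX⟩)
    (integrable_const C)
    (Eventually.of_forall fun X ε _ => ?_)
  · have := h.2
    simpa only [hF', zero_smul, add_zero, real_inner_smul_left] using this
  · have hl : HasDerivAt (fun ε : ℝ => a X + ε • b X) (b X) ε := by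
      simpa using ((hasDerivAt_id ε).smul_const (b X)).const_add (a X)
    have hed : HasDerivWithinAt e (derivWithin e (Ici 0) (‖a X + ε • b X‖ ^ 2)) (Ici 0)
        (‖a X + ε • b X‖ ^ 2) :=
      (he.differentiableOn one_ne_zero _ (sq_nonneg ‖a X + ε • b X‖)).hasDerivWithinAt
    -- A one-sided derivative of `e` at `0` suffices, since the squared norm never leaves `[0, ∞)`.
    have hcomp := hed.comp_hasDerivAt (h := fun ε : ℝ => ‖a X + ε • b X‖ ^ 2) ε hl.norm_sq
      (Eventually.of_forall fun δ => sq_nonneg ‖a X + δ • b X‖)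
    have := (hcomp.const_mul (1 / 2 : ℝ)).const_mul (J X)
    refine this.congr_deriv ?_
    simp only [hF']
    ring

lemma pullGrad_add_const_mul {x : E2 → E3} {η ζ : E2 → ℝ} {X : E2}
    (hη : DifferentiableAt ℝ η X) (hζ : DifferentiableAt ℝ ζ X) (ε : ℝ) :
    pullGrad x (fun Y => η Y + ε * ζ Y) X = pullGrad x η X + ε • pullGrad x ζ X := by
  have hd : ∀ α, coordDeriv (fun Y => η Y + ε * ζ Y) α X =
      coordDeriv η α X + ε * coordDeriv ζ α X := by
    intro α
    have := (hη.hasFDerivAt.add (hζ.hasFDerivAt.const_mul ε)).fderiv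
    have h' : fderiv ℝ (fun Y => η Y + ε * ζ Y) X = _ := this
    simp [coordDeriv, h']
  simp only [pullGrad, hd]
  module

/-! ### Transfer between the surface and the parameter domain -/

namespace EvolvingSurface

variable {T : ℝ} {S : EvolvingSurface T} {t : ℝ}

lemma integrableOn_surface_iff (ht0 : 0 ≤ t) (htT : t < T) (hinj : InjOn (S.param t) S.U)
    (g : E3 → ℝ) : IntegrableOn g (S.surface t) μHE[2] ↔
      IntegrableOn (fun X => ‖normalVec (S.param t) X‖ * g (S.param t X)) S.U := by
  have hx := S.contDiff_param_time t
  have := integrableOn_image_iff_integrableOn_normDet (f := S.param t) S.isOpen_U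
    (fun X _ => hx.contDiffAt.hasStrictFDerivAt two_ne_zero)
    (fun X hX => fderiv_injective_of_normalVec_ne_zero
      (S.normalVec_ne_zero ht0 htT (subset_closure hX))) hinj
    hx.normalVec.continuous.norm.continuousOn
    (fun X _ => (normDet_fderiv_eq_norm_normalVec _ X).symm) g
  rwa [finrank_euclideanSpace_fin] at this

lemma integral_surface (ht0 : 0 ≤ t) (htT : t < T) (hinj : InjOn (S.param t) S.U)
    (g : E3 → ℝ) : ∫ x in S.surface t, g x ∂μHE[2] =
      ∫ X in S.U, ‖normalVec (S.param t) X‖ * g (S.param t X) := by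
  have hx := S.contDiff_param_time t
  have := integral_image_eq_integral_normDet (f := S.param t) S.isOpen_U
    (fun X _ => hx.contDiffAt.hasStrictFDerivAt two_ne_zero)
    (fun X hX => fderiv_injective_of_normalVec_ne_zero
      (S.normalVec_ne_zero ht0 htT (subset_closure hX))) hinj
    hx.normalVec.continuous.norm.continuousOn
    (fun X _ => (normDet_fderiv_eq_norm_normalVec _ X).symm) g
  rwa [finrank_euclideanSpace_fin] at this

/-- The pull-back to the parameter domain, extended by zero, of a function on the surface. -/
def pullZero (S : EvolvingSurface T) (t : ℝ) (ψ : E3 → ℝ) : E2 → ℝ :=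
  S.U.indicator fun X => ψ (S.param t X)

/-- By continuity the support is mapped into the closed support of `ψ`, hence off `∂Γ(t)`, which
excludes the frontier of `U`. The second factor is not redundant: points of `U` may also be mapped
into `∂Γ(t)`. -/
lemma tsupport_pullZero_subset {ψ : E3 → ℝ}
    (hψ : Disjoint (closure {x ∈ S.surface t | ψ x ≠ 0}) (S.bdry t)) :
    tsupport (S.pullZero t ψ) ⊆ S.U ∩ S.param t ⁻¹' (S.bdry t)ᶜ := by
  have hcont : Continuous (S.param t) := (S.contDiff_param_time t).continuous
  have hsub : Function.support (S.pullZero t ψ) ⊆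
      S.U ∩ S.param t ⁻¹' {x ∈ S.surface t | ψ x ≠ 0} := by
    intro X hX
    have hXU : X ∈ S.U := by
      by_contra h
      exact hX (indicator_of_notMem h _)
    refine ⟨hXU, ⟨X, hXU, rfl⟩, fun h0 => hX ?_⟩
    rw [pullZero, indicator_of_mem hXU, h0]
  intro X hX
  have h1 : X ∈ closure S.U := closure_mono (hsub.trans inter_subset_left) hX
  have h2 : S.param t X ∉ S.bdry t := by
    refine disjoint_left.1 hψ ?_
    exact closure_minimal ((hsub.trans inter_subset_right).trans (preimage_mono subset_closure))
      (isClosed_closure.preimage hcont) hX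
  refine ⟨?_, h2⟩
  by_contra hXU
  refine h2 ⟨X, ?_, rfl⟩
  rw [S.isOpen_U.frontier_eq]
  exact ⟨h1, hXU⟩

lemma hasCompactSupport_pullZero {ψ : E3 → ℝ}
    (hψ : Disjoint (closure {x ∈ S.surface t | ψ x ≠ 0}) (S.bdry t)) :
    HasCompactSupport (S.pullZero t ψ) :=
  S.isCompact_closure_U.of_isClosed_subset (isClosed_tsupport _)
    ((tsupport_pullZero_subset hψ).trans (inter_subset_left.trans subset_closure))

lemma pullZero_eventuallyEq {ψ F : E3 → ℝ} (h : EqOn ψ F (S.surface t)) {X : E2} (hX : X ∈ S.U) :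
    S.pullZero t ψ =ᶠ[𝓝 X] fun Y => F (S.param t Y) := by
  filter_upwards [S.isOpen_U.mem_nhds hX] with Y hY
  rw [pullZero, indicator_of_mem hY]
  exact h ⟨Y, hY, rfl⟩

lemma contDiff_pullZero {ψ F : E3 → ℝ} (hF : ContDiff ℝ 1 F) (h : EqOn ψ F (S.surface t))
    (hψ : Disjoint (closure {x ∈ S.surface t | ψ x ≠ 0}) (S.bdry t)) :
    ContDiff ℝ 1 (S.pullZero t ψ) :=
  contDiff_of_forall_mem_tsupport fun X hX =>
    (hF.comp ((S.contDiff_param_time t).of_le (by norm_num))).contDiffAt.congr_of_eventuallyEq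
      (pullZero_eventuallyEq h (tsupport_pullZero_subset hψ hX).1)

/-- The surface divergence of a field that is `C¹` off the boundary, in terms of the
parametrization. -/
lemma contDiffAt_comp_param_and_div_param (hinj : InjOn (S.param t) S.U) {φ : E3 → E3}
    (hφ : S.IsC1OffBdry t φ) {X : E2} (hX : X ∈ S.U) (hb : S.param t X ∉ S.bdry t)
    (hN : normalVec (S.param t) X ≠ 0) :
    ContDiffAt ℝ 1 (fun Y => φ (S.param t Y)) X ∧
      S.div t φ (S.param t X) = ∑ j, pullGrad (S.param t) (fun Y => φ (S.param t Y) j) X j := by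
  have hx := S.contDiff_param_time t
  have hmem : S.param t X ∈ S.surface t := ⟨X, hX, rfl⟩
  obtain ⟨Φ, hΦ, hφΦ⟩ := hφ _ ⟨hmem, hb⟩
  constructor
  · refine (hΦ.comp X (hx.contDiffAt.of_le (by norm_num))).congr_of_eventuallyEq ?_
    have ht : Tendsto (S.param t) (𝓝 X) (𝓝[S.surface t] (S.param t X)) :=
      tendsto_nhdsWithin_iff.2 ⟨hx.continuous.continuousAt, by
        filter_upwards [S.isOpen_U.mem_nhds hX] with Y hY using ⟨Y, hY, rfl⟩⟩
    exact ht.eventually hφΦ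
  · refine Finset.sum_congr rfl fun j _ => tderiv_param hinj hX hN ?_ j
    have hd : DifferentiableWithinAt ℝ φ (S.surface t) (S.param t X) :=
      (hΦ.differentiableAt one_ne_zero).differentiableWithinAt.congr_of_eventuallyEq hφΦ
        (hφΦ.self_of_nhdsWithin hmem)
    exact (EuclideanSpace.proj j : E3 →L[ℝ] ℝ).differentiableAt.comp_differentiableWithinAt _ hd

end EvolvingSurface

end

/-! ### The variation formula -/

/-- Variation of the dissipation energy. For `t > 0` the hypothesis `hinj` holds by the definition of
an evolving surface. -/
theorem theorem2p5 {T : ℝ} (S : EvolvingSurface T) (t : ℝ) (ht0 : 0 ≤ t) (htT : t < T)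
    (hinj : Set.InjOn (S.param t) S.U)
    (e : ℝ → ℝ) (he : ContDiffOn ℝ 1 e (Set.Ici 0))
    (f : E3 → ℝ) (hf : S.IsCk t 2 f) :
    -- the surface divergence of the flux makes sense whenever `e` is `C²`
    (ContDiffOn ℝ 2 e (Set.Ici 0) → S.IsC1OffBdry t (S.flux t e f)) ∧
    ∀ ψ : E3 → ℝ, S.IsCk0 t 1 ψ →
      -- the energies are integrals of integrable functions
      (∀ ε : ℝ, -1 < ε → ε < 1 →
        IntegrableOn (fun x => 1 / 2 * e (‖S.grad t (fun y => f y + ε * ψ y) x‖ ^ 2))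
          (S.surface t) μHE[2]) ∧
      -- the formula holds whenever the surface divergence of the flux makes sense
      (S.IsC1OffBdry t (S.flux t e f) →
        IntegrableOn (fun x => S.div t (S.flux t e f) x * ψ x) (S.surface t) μHE[2] ∧
        HasDerivAt (fun ε : ℝ => S.energy t e (fun y => f y + ε * ψ y))
          (∫ x in S.surface t, S.div t (S.flux t e f) x * ψ x ∂μHE[2]) 0) := by
  refine ⟨fun he2 => S.isC1OffBdry_flux ht0 htT hinj he2 hf, ?_⟩
  rintro ψ ⟨⟨P, hP, hψP⟩, hψ⟩
  obtain ⟨F, hF, hfF⟩ := hf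
  replace hF : ContDiff ℝ 2 F := by exact_mod_cast hF
  replace hP : ContDiff ℝ 1 P := by exact_mod_cast hP
  have hfF' : EqOn f F (S.surface t) := hfF.mono subset_closure
  have hx := S.contDiff_param_time t
  have hx1 : ContDiff ℝ 1 (S.param t) := hx.of_le (by norm_num)
  have hN : ∀ X ∈ closure S.U, normalVec (S.param t) X ≠ 0 := fun X hX =>
    S.normalVec_ne_zero ht0 htT hX
  have hUm : MeasurableSet S.U := S.isOpen_U.measurableSet
  set a := pullGrad (S.param t) (fun Y => F (S.param t Y)) with ha
  set b := pullGrad (S.param t) (fun Y => P (S.param t Y)) with hb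
  set η := S.pullZero t ψ with hη
  have hηsub := S.tsupport_pullZero_subset hψ
  have hηU : tsupport η ⊆ S.U := hηsub.trans inter_subset_left
  have hF1 : ContDiff ℝ 1 F := hF.of_le (by norm_num)
  have hgrad : ∀ ε : ℝ, ∀ X ∈ S.U,
      S.grad t (fun y => f y + ε * ψ y) (S.param t X) = a X + ε • b X := by
    intro ε X hX
    rw [S.grad_param_of_eqOn hinj hX (hN X (subset_closure hX))
      (F := fun y => F y + ε * P y)
      ((hF1.add (contDiff_const.mul hP)).differentiable one_ne_zero)
      (fun y hy => by simp only [hfF' hy, hψP hy])]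
    exact pullGrad_add_const_mul ((hF1.comp hx1).differentiable one_ne_zero X)
      ((hP.comp hx1).differentiable one_ne_zero X) ε
  obtain ⟨hint, hderiv⟩ := hasDerivAt_integral_energy_density hUm S.isCompact_closure_U he
    (continuousOn_pullGrad hx (hF1.comp hx1) hN) (continuousOn_pullGrad hx (hP.comp hx1) hN)
    (hx.normalVec.continuous.norm.continuousOn)
  refine ⟨fun ε _ _ => ?_, fun hflux => ?_⟩
  · rw [S.integrableOn_surface_iff ht0 htT hinj]
    refine (hint ε).congr_fun (fun X hX => ?_) hUm
    simp only [hgrad ε X hX]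
    rfl
  have hfluxU : ∀ X ∈ S.U, S.flux t e f (S.param t X) =
      derivWithin e (Ici 0) (‖a X‖ ^ 2) • a X := by
    intro X hX
    rw [EvolvingSurface.flux, S.grad_param_of_eqOn hinj hX (hN X (subset_closure hX))
      (hF1.differentiable one_ne_zero) hfF']
  have hpull := fun X (hX : X ∈ tsupport η) =>
    S.contDiffAt_comp_param_and_div_param hinj hflux (hηsub hX).1 (hηsub hX).2
      (hN X (subset_closure (hηU hX)))
  obtain ⟨hdivI, hdiv⟩ := integral_inner_pullGrad_eq_neg_integral_div hx
    (φ := fun X => S.flux t e f (S.param t X)) (S.contDiff_pullZero hP hψP hψ)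
    (S.hasCompactSupport_pullZero hψ) (fun X hX => hN X (subset_closure (hηU hX)))
    (fun X hX => (hpull X hX).1) (fun X hX => by
      rw [hfluxU X (hηU hX), real_inner_smul_left, inner_pullGrad_normalVec, mul_zero])
  have hηψ : ∀ X ∈ S.U, η X = ψ (S.param t X) := fun X hX => indicator_of_mem hX _
  have hηb : ∀ X ∈ S.U, pullGrad (S.param t) η X = b X := fun X hX =>
    pullGrad_congr (S.pullZero_eventuallyEq hψP hX)
  have hrhs : ∀ X ∈ S.U, ‖normalVec (S.param t) X‖ *
      ((∑ j, pullGrad (S.param t) (fun Y => S.flux t e f (S.param t Y) j) X j) * η X) =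
      ‖normalVec (S.param t) X‖ *
        (S.div t (S.flux t e f) (S.param t X) * ψ (S.param t X)) := by
    intro X hX
    -- Off the support the coordinate formula for the divergence may fail, for instance over
    -- `∂Γ(t)`, but both sides vanish with `ψ`.
    by_cases hXη : X ∈ tsupport η
    · rw [hηψ X hX, (hpull X hXη).2]
    · rw [← hηψ X hX, image_eq_zero_of_notMem_tsupport hXη]
      simp
  constructor
  · rw [S.integrableOn_surface_iff ht0 htT hinj]
    exact hdivI.integrableOn.congr_fun hrhs hUm
  · have hE : (fun ε : ℝ => S.energy t e (fun y => f y + ε * ψ y)) = fun ε : ℝ =>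
        -∫ X in S.U, ‖normalVec (S.param t) X‖ * (1 / 2 * e (‖a X + ε • b X‖ ^ 2)) := by
      ext ε
      rw [EvolvingSurface.energy, S.integral_surface ht0 htT hinj]
      congr 1
      exact setIntegral_congr_fun hUm fun X hX => by simp only [hgrad ε X hX]
    rw [hE]
    refine hderiv.neg.congr_deriv ?_
    have hzero : ∀ X ∉ S.U, ‖normalVec (S.param t) X‖ *
        ((∑ j, pullGrad (S.param t) (fun Y => S.flux t e f (S.param t Y) j) X j) * η X) = 0 :=
      fun X hX => by
        rw [image_eq_zero_of_notMem_tsupport fun h => hX (hηU h), mul_zero, mul_zero]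
    have hzero' : ∀ X ∉ S.U, ‖normalVec (S.param t) X‖ *
        inner ℝ (S.flux t e f (S.param t X)) (pullGrad (S.param t) η X) = 0 := fun X hX => by
      have h0 := notMem_tsupport_iff_eventuallyEq.1 fun h => hX (hηU h)
      rw [pullGrad_congr h0]
      simp [pullGrad, coordDeriv, show (0 : E2 → ℝ) = fun _ => 0 from rfl]
    -- Both integrands vanish outside `U`, so the integrals over `U` are integrals over the plane,
    -- where the integration by parts `hdiv` holds.
    rw [S.integral_surface ht0 htT hinj, ← setIntegral_congr_fun hUm hrhs,
      setIntegral_eq_integral_of_forall_compl_eq_zero hzero, ← neg_eq_iff_eq_neg.2 hdiv,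
      ← setIntegral_eq_integral_of_forall_compl_eq_zero hzero']
    refine congrArg _ (setIntegral_congr_fun hUm fun X hX => ?_)
    simp only [hηb X hX, hfluxU X hX]
    rfl
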